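/- Let $\kappa:[0,\infty)\to\mathbb R$ be concave, non-decreasing and differentiable (one-sidedly at $0$), with $\kappa(0)=0$, with $\rho$-Lipschitz derivative $\kappa'$, and such that $\kappa'$ fails to be differentiable at only finitely many points; put $\kappa_0=\kappa'(0)$. Let $\mu\ge 0$ and $f:\mathbb R^{m\times n}\to\mathbb R$, and for a matrix $X\in\mathbb R^{m\times n}$ with singular values $\sigma_1(X)\ge\sigma_2(X)\ge\dots\ge 0$ (continued by zeros) define $$\bar f(X)=f(X)+\bar g(X),\qquad \bar g(X)=\mu\sum_{i=1}^m\bigl(\kappa(\sigma_i(X))-\kappa_0\,\sigma_i(X)\bigr).$$ Let $X=UBV^\top$, where $U\in\mathbb R^{m\times k}$ and $V\in\mathbb R^{n\times k}$ have orthonormal columns ($U^\top U=V^\top V=I$) and $B\in\mathbb R^{k\times k}$ is symmetric positive semidefinite, and let $B=U_B\,\mathrm{Diag}(\sigma_1(B),\dots,\sigma_k(B))\,V_B^\top$ be a singular value decomposition of $B$, with $U_B,V_B\in\mathbb R^{k\times k}$ orthogonal. If $f$ is differentiable at $X$ (in particular, if $f$ is differentiable with Lipschitz gradient), then $\bar f$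 is differentiable at $X$, and with gradients taken with respect to the inner product $\langle X,Y\rangle=\sum_{i,j}X_{ij}Y_{ij}$, $$\nabla\bar f(X)=\nabla f(X)+\mu\,(UU_B)\,\mathrm{Diag}(w)\,(VV_B)^\top,\qquad w_i=\kappa'(\sigma_i(B))-\kappa_0,\quad i=1,\dots,k.$$ -/

import Mathlib

open scoped NNReal Gradient

attribute [local instance] Matrix.frobeniusNormedAddCommGroup Matrix.frobeniusNormedSpace

namespace LowRankGrad

/-- The inner product `⟨X, Y⟩ = ∑ i j, X i j * Y i j` on real matrices. The norm it induces is the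
Frobenius norm, so gradients of functions of a matrix are taken with respect to it. -/
@[reducible]
noncomputable def frobeniusInnerProductSpace (m n : ℕ) :
    InnerProductSpace ℝ (Matrix (Fin m) (Fin n) ℝ) where
  toNormedSpace := Matrix.frobeniusNormedSpace
  inner X Y := ∑ i, ∑ j, X i j * Y i j
  norm_sq_eq_re_inner X := by
    rw [Matrix.frobenius_norm_def, ← Real.sqrt_eq_rpow, Real.sq_sqrt (by positivity)]
    simp [sq]
  conj_inner_symm X Y := by simp [mul_comm]
  add_left X Y Z := by simp [add_mul, Finset.sum_add_distrib]
  smul_left X Y r := by simp [Finset.mul_sum, mul_assoc]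

/-- The requirements on the function `κ` defining the regularizer. Only the values of `κ` on
`[0, ∞)` matter; derivatives are taken in `[0, ∞)`, hence one-sided at `0`. -/
structure IsPenalty (κ : ℝ → ℝ) (ρ : ℝ≥0) : Prop where
  concave : ConcaveOn ℝ (Set.Ici 0) κ
  monotone : MonotoneOn κ (Set.Ici 0)
  map_zero : κ 0 = 0
  differentiable : DifferentiableOn ℝ κ (Set.Ici 0)
  lipschitz_deriv : LipschitzOnWith ρ (derivWithin κ (Set.Ici 0)) (Set.Ici 0)
  finite_nondiff : {α ∈ Set.Ici (0 : ℝ) |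
    ¬ DifferentiableWithinAt ℝ (derivWithin κ (Set.Ici 0)) (Set.Ici 0) α}.Finite

/-- `κ'(α)` for `α ≥ 0`, the derivative of `κ` as a function on `[0, ∞)`. -/
noncomputable def kappaDeriv (κ : ℝ → ℝ) (α : ℝ) : ℝ := derivWithin κ (Set.Ici 0) α

/-- `κ₀ = κ'(0)`. -/
noncomputable def kappaZero (κ : ℝ → ℝ) : ℝ := kappaDeriv κ 0

/-- The singular values of `X` in non-increasing order, numbered from `0` and continued by
zeros. -/
noncomputable def sigma {m n : ℕ} (X : Matrix (Fin m) (Fin n) ℝ) (i : ℕ) : ℝ :=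
  (Matrix.toEuclideanLin X).singularValues i

/-- `ḡ(X) = μ ∑ᵢ (κ(σᵢ(X)) - κ₀ σᵢ(X))`. -/
noncomputable def gBar (κ : ℝ → ℝ) (μ : ℝ) {m n : ℕ} (X : Matrix (Fin m) (Fin n) ℝ) : ℝ :=
  μ * ∑ i : Fin m, (κ (sigma X i) - kappaZero κ * sigma X i)

/-- `f̄ = f + ḡ`. -/
noncomputable def fBar {m n : ℕ} (f : Matrix (Fin m) (Fin n) ℝ → ℝ) (κ : ℝ → ℝ) (μ : ℝ)
    (X : Matrix (Fin m) (Fin n) ℝ) : ℝ :=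
  f X + gBar κ μ X

/-- `B = U_B Diag(σ₁(B), …, σₖ(B)) V_Bᵀ` with orthogonal `U_B`, `V_B` is a singular value
decomposition of the square matrix `B`. -/
structure IsSVD {k : ℕ} (B UB VB : Matrix (Fin k) (Fin k) ℝ) : Prop where
  left_mem : UB ∈ Matrix.orthogonalGroup (Fin k) ℝ
  right_mem : VB ∈ Matrix.orthogonalGroup (Fin k) ℝ
  eq : B = UB * Matrix.diagonal (fun i : Fin k => sigma B i) * VB.transpose

end LowRankGrad

attribute [local instance] LowRankGrad.frobeniusInnerProductSpace

/-!
Put `h(α) = κ₀ α - κ(α)` on `[0, ∞)`. Then `f̄ = f - μ G` with `G(X) = ∑ᵢ h(σᵢ(X))`, and the point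
is that `G` is differentiable, although individual singular values are not. Both `h` and
`α ↦ ρ/2 α² - h(α)` are convex with non-negative non-decreasing derivative on `[0, ∞)`: the first
because `κ` is concave and `h'(0) = 0`, the second because `h'` is moreover `ρ`-Lipschitz.

For any such function `φ` and any singular value expansion `X = ∑ᵢ sᵢ pᵢ qᵢᵀ`, the matrix
`W = ∑ᵢ φ'(sᵢ) pᵢ qᵢᵀ` is a subgradient of `Y ↦ ∑ᵢ φ(σᵢ(Y))` at `X`
(`IsSingularExpansion.sum_add_inner_le`). Indeed `⟨W, X⟩ = ∑ᵢ φ'(sᵢ) sᵢ`, while von Neumann's trace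
inequality (`inner_sum_vecMulVec_le`) gives `⟨W, Y⟩ ≤ ∑ᵢ φ'(sᵢ) σᵢ(Y)`, so the claim reduces to the
scalar tangent line inequality for `φ`.

Applied to `h`, this bounds `G(Y) - G(X) - ⟨W, Y - X⟩` below by `0`; applied to `ρ/2 α² - h(α)`,
whose spectral sum is `ρ/2 ‖Y‖² - G(Y)`, it bounds the same quantity above by `ρ/2 ‖Y - X‖²`.
Hence `∇G(X) = W` (`hasGradientAt_sum_gap`).

The trace inequality comes from Bessel's inequality, which makes the relevant coefficients
substochastic, and two summations by parts. It also yields the uniqueness of singular values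
(`IsSingularExpansion.singularValues_unique`), which identifies the singular values of `X = U B Vᵀ`
with those of `B`.
-/

namespace LowRankGrad

open Matrix Finset

/-! ### Rearrangement with substochastic weights -/

/-- Summation by parts: a non-increasing non-negative weight preserves the non-negativity of partial
sums. -/
theorem sum_mul_nonneg_of_antitone {d e : ℕ → ℝ} (hd : Antitone d) (hd0 : ∀ i, 0 ≤ d i) {N : ℕ}
    (he : ∀ r ≤ N, 0 ≤ ∑ i ∈ range r, e i) : 0 ≤ ∑ i ∈ range N, d i * e i := by
  -- The factor `d r` on the left is what makes the induction on `r` close.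
  have key : ∀ r ≤ N, d r * ∑ i ∈ range r, e i ≤ ∑ i ∈ range r, d i * e i := by
    intro r
    induction r with
    | zero => simp
    | succ r ih =>
      intro hr
      have h := mul_le_mul_of_nonneg_right (hd (Nat.le_succ r)) (he (r + 1) hr)
      have h' := ih (by omega)
      rw [sum_range_succ] at h ⊢
      rw [sum_range_succ]
      simp only [Nat.succ_eq_add_one] at h
      nlinarith
  exact (mul_nonneg (hd0 N) (he N le_rfl)).trans (key N le_rfl)

theorem sum_mul_le_sum_mul_of_antitone {d t u : ℕ → ℝ} (hd : Antitone d) (hd0 : ∀ i, 0 ≤ d i)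
    {N : ℕ} (h : ∀ r ≤ N, ∑ i ∈ range r, t i ≤ ∑ i ∈ range r, u i) :
    ∑ i ∈ range N, d i * t i ≤ ∑ i ∈ range N, d i * u i := by
  have := sum_mul_nonneg_of_antitone (e := fun i => u i - t i) hd hd0 (N := N) (by
    intro r hr
    rw [sum_sub_distrib]
    linarith [h r hr])
  simp only [mul_sub, sum_sub_distrib] at this
  linarith

/-- Pairing two non-increasing non-negative sequences through a doubly substochastic matrix gives at
most the diagonal pairing. -/
theorem sum_sum_le_of_substochastic {s d : ℕ → ℝ} (hs : Antitone s) (hs0 : ∀ i, 0 ≤ s i)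
    (hd : Antitone d) (hd0 : ∀ i, 0 ≤ d i) {N : ℕ} {c : ℕ → ℕ → ℝ} (hc : ∀ i j, 0 ≤ c i j)
    (hrow : ∀ i, ∑ j ∈ range N, c i j ≤ 1) (hcol : ∀ j, ∑ i ∈ range N, c i j ≤ 1) :
    ∑ i ∈ range N, ∑ j ∈ range N, s i * d j * c i j ≤ ∑ i ∈ range N, s i * d i := by
  -- Compare partial sums first against the weight `s`, then, inside, against the weight `d`; what
  -- remains is `∑ i < r, ∑ j < l, c i j ≤ min r l`.
  simp only [mul_assoc, ← mul_sum]
  refine sum_mul_le_sum_mul_of_antitone hs hs0 fun r hr => ?_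
  rw [sum_comm]
  simp only [← mul_sum]
  have hr' : ∑ i ∈ range r, d i = ∑ j ∈ range N, d j * if j < r then 1 else 0 := by
    simp only [mul_ite, mul_one, mul_zero, ← sum_filter]
    congr 1
    ext j
    simp only [mem_range, mem_filter]
    omega
  rw [hr']
  refine sum_mul_le_sum_mul_of_antitone hd hd0 fun l hl => ?_
  rcases le_total l r with hlr | hrl
  · refine sum_le_sum fun j hj => ?_
    rw [if_pos (by grind)]
    exact (sum_le_sum_of_subset_of_nonneg (by simpa using hr) fun i _ _ => hc i j).trans (hcol j)
  · rw [sum_comm]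
    have : ∑ j ∈ range l, (if j < r then (1 : ℝ) else 0) = ∑ i ∈ range r, 1 := by
      rw [← sum_filter]
      congr 1
      ext j
      simp only [mem_range, mem_filter]
      omega
    rw [this]
    refine sum_le_sum fun i _ => ?_
    exact (sum_le_sum_of_subset_of_nonneg (by simpa using hl) fun j _ _ => hc i j).trans (hrow i)

/-! ### The trace inequality -/

/-- A sequence of pairwise orthogonal vectors of length at most `1`. Vectors shorter than `1` are
allowed, so that a finite orthonormal family can be continued by zeros; Bessel's inequality still
holds. -/
structure IsOrthoSystem {l : ℕ} (p : ℕ → Fin l → ℝ) : Prop where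
  orthogonal : ∀ i j, i ≠ j → p i ⬝ᵥ p j = 0
  self_le : ∀ i, p i ⬝ᵥ p i ≤ 1

theorem IsOrthoSystem.bessel {l : ℕ} {p : ℕ → Fin l → ℝ} (hp : IsOrthoSystem p) (N : ℕ)
    (x : Fin l → ℝ) : ∑ i ∈ range N, (p i ⬝ᵥ x) ^ 2 ≤ x ⬝ᵥ x := by
  set y : Fin l → ℝ := ∑ i ∈ range N, (p i ⬝ᵥ x) • p i with hy
  have h0 : 0 ≤ (x - y) ⬝ᵥ (x - y) := sum_nonneg fun i _ => mul_self_nonneg _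
  have h1 : y ⬝ᵥ x = ∑ i ∈ range N, (p i ⬝ᵥ x) ^ 2 := by
    rw [hy, sum_dotProduct]
    exact sum_congr rfl fun i _ => by rw [smul_dotProduct, smul_eq_mul, sq]
  have h2 : y ⬝ᵥ y ≤ ∑ i ∈ range N, (p i ⬝ᵥ x) ^ 2 := by
    conv_lhs => rw [hy, sum_dotProduct]
    refine sum_le_sum fun i hi => ?_
    rw [dotProduct_sum, sum_eq_single i]
    · rw [smul_dotProduct, dotProduct_smul, smul_eq_mul, smul_eq_mul]
      nlinarith [hp.self_le i, sq_nonneg (p i ⬝ᵥ x)]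
    · intro j _ hj
      rw [smul_dotProduct, dotProduct_smul, hp.orthogonal i j hj.symm, smul_zero, smul_zero]
    · exact fun h => absurd hi h
  rw [sub_dotProduct, dotProduct_sub, dotProduct_sub, dotProduct_comm x y, h1] at h0
  linarith

variable {m n : ℕ}

theorem inner_vecMulVec (a c : Fin m → ℝ) (b d : Fin n → ℝ) :
    inner ℝ (vecMulVec a b) (vecMulVec c d) = (a ⬝ᵥ c) * (b ⬝ᵥ d) := by
  change ∑ i, ∑ j, vecMulVec a b i j * vecMulVec c d i j = _
  simp only [vecMulVec_apply, dotProduct, sum_mul_sum]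
  exact sum_congr rfl fun i _ => sum_congr rfl fun j _ => by ring

theorem inner_sum_vecMulVec (N : ℕ) (s d : ℕ → ℝ) (p p' : ℕ → Fin m → ℝ) (q q' : ℕ → Fin n → ℝ) :
    inner ℝ (∑ i ∈ range N, s i • vecMulVec (p i) (q i))
        (∑ i ∈ range N, d i • vecMulVec (p' i) (q' i)) =
      ∑ i ∈ range N, ∑ j ∈ range N, s i * d j * ((p i ⬝ᵥ p' j) * (q i ⬝ᵥ q' j)) := by
  rw [sum_inner]
  refine sum_congr rfl fun i _ => ?_
  rw [inner_sum]
  refine sum_congr rfl fun j _ => ?_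
  rw [real_inner_smul_left, real_inner_smul_right, inner_vecMulVec]
  ring

/-- Von Neumann's trace inequality, for matrices given as combinations of the rank one matrices
`pᵢ qᵢᵀ`. -/
theorem inner_sum_vecMulVec_le {s d : ℕ → ℝ} (hs : Antitone s) (hs0 : ∀ i, 0 ≤ s i)
    (hd : Antitone d) (hd0 : ∀ i, 0 ≤ d i) {p p' : ℕ → Fin m → ℝ} {q q' : ℕ → Fin n → ℝ}
    (hp : IsOrthoSystem p) (hq : IsOrthoSystem q) (hp' : IsOrthoSystem p')
    (hq' : IsOrthoSystem q') (N : ℕ) :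
    inner ℝ (∑ i ∈ range N, s i • vecMulVec (p i) (q i))
        (∑ i ∈ range N, d i • vecMulVec (p' i) (q' i)) ≤ ∑ i ∈ range N, s i * d i := by
  rw [inner_sum_vecMulVec]
  have hbound : ∀ i j, (p i ⬝ᵥ p' j) * (q i ⬝ᵥ q' j) ≤
      ((p i ⬝ᵥ p' j) ^ 2 + (q i ⬝ᵥ q' j) ^ 2) / 2 := fun i j => by
    nlinarith [sq_nonneg (p i ⬝ᵥ p' j - q i ⬝ᵥ q' j)]
  refine le_trans (sum_le_sum fun i _ => sum_le_sum fun j _ =>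
    mul_le_mul_of_nonneg_left (hbound i j) (mul_nonneg (hs0 i) (hd0 j))) ?_
  refine sum_sum_le_of_substochastic hs hs0 hd hd0 (fun i j => by positivity) ?_ ?_
  · intro i
    rw [← sum_div, sum_add_distrib]
    simp only [dotProduct_comm (p i), dotProduct_comm (q i)]
    linarith [hp'.bessel N (p i), hq'.bessel N (q i), hp.self_le i, hq.self_le i]
  · intro j
    rw [← sum_div, sum_add_distrib]
    linarith [hp.bessel N (p' j), hq.bessel N (q' j), hp'.self_le j, hq'.self_le j]

/-! ### Singular value expansions -/

/-- `X = ∑_{i < N} sᵢ pᵢ qᵢᵀ` is a singular value expansion of `X` with singular values `s`. The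
vectors `pᵢ`, `qᵢ` belonging to `sᵢ ≠ 0` are orthonormal; those belonging to `sᵢ = 0` may be
anything orthogonal to the others and of length at most `1`, for example `0`. -/
structure IsSingularExpansion (N : ℕ) (s : ℕ → ℝ) (p : ℕ → Fin m → ℝ) (q : ℕ → Fin n → ℝ)
    (X : Matrix (Fin m) (Fin n) ℝ) : Prop where
  antitone : Antitone s
  nonneg : ∀ i, 0 ≤ s i
  left : IsOrthoSystem p
  right : IsOrthoSystem q
  left_norm : ∀ i, s i * (p i ⬝ᵥ p i) = s i
  right_norm : ∀ i, s i * (q i ⬝ᵥ q i) = s i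
  eq : X = ∑ i ∈ range N, s i • vecMulVec (p i) (q i)

namespace IsSingularExpansion

variable {N : ℕ} {s : ℕ → ℝ} {p : ℕ → Fin m → ℝ} {q : ℕ → Fin n → ℝ}
  {X : Matrix (Fin m) (Fin n) ℝ}

/-- A combination of the rank one matrices of an expansion of `X` pairs with `X` diagonally; the
coefficients belonging to vanishing singular values do not matter. -/
theorem inner_eq (h : IsSingularExpansion N s p q X) (d : ℕ → ℝ) :
    inner ℝ (∑ i ∈ range N, d i • vecMulVec (p i) (q i)) X = ∑ i ∈ range N, d i * s i := by
  rw [h.eq, inner_sum_vecMulVec]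
  refine sum_congr rfl fun i hi => ?_
  rw [sum_eq_single i]
  · linear_combination d i * (q i ⬝ᵥ q i) * h.left_norm i + d i * h.right_norm i
  · intro j _ hj
    rw [h.left.orthogonal i j hj.symm]
    ring
  · exact fun h => absurd hi h

theorem norm_sq_eq (h : IsSingularExpansion N s p q X) :
    ‖X‖ ^ 2 = ∑ i ∈ range N, s i ^ 2 := by
  rw [← real_inner_self_eq_norm_sq X]
  conv_lhs => enter [2]; rw [h.eq]
  rw [h.inner_eq]
  simp only [sq]

/-- The sum of the first `r` coefficients of one expansion is the pairing of `X` with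
`∑_{i < r} pᵢ qᵢᵀ`, which the trace inequality for the other expansion bounds (Ky Fan). -/
theorem sum_le_sum {s' : ℕ → ℝ} {p' : ℕ → Fin m → ℝ}
    {q' : ℕ → Fin n → ℝ} (h : IsSingularExpansion N s p q X)
    (h' : IsSingularExpansion N s' p' q' X) {r : ℕ} (hr : r ≤ N) :
    ∑ i ∈ range r, s i ≤ ∑ i ∈ range r, s' i := by
  have hsum : ∀ t : ℕ → ℝ,
      ∑ i ∈ range r, t i = ∑ i ∈ range N, (if i < r then 1 else 0) * t i := by
    intro t
    simp only [ite_mul, one_mul, zero_mul, ← sum_filter]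
    congr 1
    ext j
    simp only [mem_range, mem_filter]
    omega
  rw [hsum, hsum, ← h.inner_eq]
  conv_lhs => rw [h'.eq]
  refine inner_sum_vecMulVec_le ?_ ?_ h'.antitone h'.nonneg h.left h.right h'.left h'.right N
  · intro i j hij
    dsimp only
    split_ifs
    · exact le_rfl
    · omega
    · exact zero_le_one
    · exact le_rfl
  · intro i
    split_ifs <;> norm_num

theorem singularValues_unique {s' : ℕ → ℝ} {p' : ℕ → Fin m → ℝ} {q' : ℕ → Fin n → ℝ}
    (h : IsSingularExpansion N s p q X) (h' : IsSingularExpansion N s' p' q' X) {i : ℕ}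
    (hi : i < N) : s i = s' i := by
  have key : ∀ r ≤ N, ∑ i ∈ range r, s i = ∑ i ∈ range r, s' i := fun r hr =>
    le_antisymm (h.sum_le_sum h' hr) (h'.sum_le_sum h hr)
  have h1 := key (i + 1) hi
  rw [sum_range_succ, sum_range_succ, key i hi.le] at h1
  linarith

end IsSingularExpansion

theorem sigma_antitone (X : Matrix (Fin m) (Fin n) ℝ) : Antitone (sigma X) :=
  LinearMap.singularValues_antitone _

theorem sigma_nonneg (X : Matrix (Fin m) (Fin n) ℝ) (i : ℕ) : 0 ≤ sigma X i :=
  LinearMap.singularValues_nonneg _ i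

theorem sigma_eq_zero_of_le_right (X : Matrix (Fin m) (Fin n) ℝ) {i : ℕ} (hi : n ≤ i) :
    sigma X i = 0 :=
  LinearMap.singularValues_of_finrank_le _ (by simpa using hi)

theorem sigma_eq_zero_of_le_left (X : Matrix (Fin m) (Fin n) ℝ) {i : ℕ} (hi : m ≤ i) :
    sigma X i = 0 := by
  refine (LinearMap.singularValues_eq_zero_iff_le_finrank_range _).2
    ((Submodule.finrank_le _).trans ?_)
  simpa using hi

/-- The right singular vectors are an orthonormal eigenbasis `qᵢ` of `XᵀX`, and `pᵢ = σᵢ⁻¹ X qᵢ`. -/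
theorem exists_isSingularExpansion (X : Matrix (Fin m) (Fin n) ℝ) {N : ℕ} (hN : n ≤ N) :
    ∃ p q, IsSingularExpansion N (sigma X) p q X := by
  have hfin : Module.finrank ℝ (EuclideanSpace ℝ (Fin n)) = n := by simp
  set T := toEuclideanLin X with hT
  set b := T.isSymmetric_adjoint_comp_self.eigenvectorBasis hfin with hb
  have hinner : ∀ {l : ℕ} (x y : EuclideanSpace ℝ (Fin l)), x.ofLp ⬝ᵥ y.ofLp = inner ℝ x y := by
    intro l x y
    simp [dotProduct, PiLp.inner_apply, mul_comm]
  have hbb : ∀ i j, inner ℝ (b i) (b j) = if i = j then (1 : ℝ) else 0 := fun i j =>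
    orthonormal_iff_ite.1 b.orthonormal i j
  have hTb : ∀ i j, inner ℝ (T (b i)) (T (b j)) = if i = j then sigma X i ^ 2 else 0 := by
    intro i j
    rw [← LinearMap.adjoint_inner_left, ← LinearMap.comp_apply,
      LinearMap.IsSymmetric.apply_eigenvectorBasis, inner_smul_left, hbb,
      ← LinearMap.sq_singularValues_fin]
    simp [sigma, hT]
  set q : ℕ → Fin n → ℝ := fun i => if h : i < n then (b ⟨i, h⟩).ofLp else 0 with hq
  -- If `σᵢ = 0`, the convention `0⁻¹ = 0` makes `pᵢ = 0`, which an expansion allows.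
  set p : ℕ → Fin m → ℝ := fun i => (sigma X i)⁻¹ • (X *ᵥ q i) with hp
  have hq1 : ∀ {i j}, i ≠ j → q i ⬝ᵥ q j = 0 := by
    intro i j hij
    simp only [hq]
    split_ifs with hi hj
    · rw [hinner, hbb, if_neg (by simpa using hij)]
    all_goals simp
  have hq2 : ∀ {i}, i < n → q i ⬝ᵥ q i = 1 := by
    intro i hi
    simp only [hq, dif_pos hi]
    rw [hinner, hbb, if_pos rfl]
  have hXq : ∀ i j, (X *ᵥ q i) ⬝ᵥ (X *ᵥ q j) = if i = j then sigma X i ^ 2 else 0 := by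
    intro i j
    by_cases hi : i < n
    · by_cases hj : j < n
      · have := hTb ⟨i, hi⟩ ⟨j, hj⟩
        rw [← hinner] at this
        simpa [hq, hi, hj, hT] using this
      · simp only [hq, dif_neg hj, mulVec_zero, dotProduct_zero]
        rw [if_neg (by omega)]
    · simp only [hq, dif_neg hi, mulVec_zero, zero_dotProduct]
      rw [sigma_eq_zero_of_le_right X (not_lt.1 hi)]
      simp
  have hsp : ∀ i, sigma X i • p i = X *ᵥ q i := by
    intro i
    by_cases h0 : sigma X i = 0
    · have := hXq i i
      rw [if_pos rfl, h0] at this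
      have h1 : X *ᵥ q i = 0 := by simpa using this
      rw [h1, h0, zero_smul]
    · simp only [hp]
      rw [smul_inv_smul₀ h0]
  have hpp : ∀ i, sigma X i ≠ 0 → p i ⬝ᵥ p i = 1 := by
    intro i h0
    simp only [hp, smul_dotProduct, dotProduct_smul, hXq, if_true, smul_eq_mul]
    field_simp
  refine ⟨p, q, sigma_antitone X, sigma_nonneg X, ⟨?_, ?_⟩, ⟨fun i j => hq1, ?_⟩, ?_, ?_, ?_⟩
  · intro i j hij
    simp [hp, smul_dotProduct, dotProduct_smul, hXq, hij]
  · intro i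
    by_cases h0 : sigma X i = 0
    · simp [hp, h0]
    · exact (hpp i h0).le
  · intro i
    by_cases hi : i < n
    · exact (hq2 hi).le
    · simp [hq, hi]
  · intro i
    by_cases h0 : sigma X i = 0
    · simp [h0]
    · rw [hpp i h0, mul_one]
  · intro i
    by_cases hi : i < n
    · rw [hq2 hi, mul_one]
    · rw [sigma_eq_zero_of_le_right X (not_lt.1 hi), zero_mul]
  · have hid : ∑ i ∈ range N, vecMulVec (q i) (q i) = 1 := by
      rw [← sum_subset (range_subset_range.2 hN) (fun i _ hi => by
        simp only [hq, dif_neg (show ¬ i < n by simpa using hi), zero_vecMulVec]), ← Fin.sum_univ_eq_sum_range]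
      ext a c
      have := b.sum_inner_mul_inner (EuclideanSpace.single a (1 : ℝ)) (EuclideanSpace.single c 1)
      rw [Matrix.sum_apply, Matrix.one_apply]
      simpa [hq, vecMulVec_apply, EuclideanSpace.inner_single_left,
        EuclideanSpace.inner_single_right, eq_comm] using this
    simp only [← smul_vecMulVec, hsp, ← mul_vecMulVec]
    rw [← Matrix.mul_sum, hid, Matrix.mul_one]

theorem IsSingularExpansion.eq_sigma {N : ℕ} {s : ℕ → ℝ} {p : ℕ → Fin m → ℝ}
    {q : ℕ → Fin n → ℝ} {X : Matrix (Fin m) (Fin n) ℝ} (h : IsSingularExpansion N s p q X)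
    (hN : n ≤ N) {i : ℕ} (hi : i < N) : s i = sigma X i := by
  obtain ⟨p', q', h'⟩ := exists_isSingularExpansion X hN
  exact h.singularValues_unique h' hi

/-! ### Subgradients of spectral sums -/

/-- The subgradient inequality for `Y ↦ ∑ᵢ φ(σᵢ(Y))`, where `φ` has non-negative non-decreasing
slopes `φ'` and lies above its tangent lines. -/
theorem IsSingularExpansion.sum_add_inner_le {N : ℕ} {s : ℕ → ℝ} {p : ℕ → Fin m → ℝ}
    {q : ℕ → Fin n → ℝ} {X : Matrix (Fin m) (Fin n) ℝ} (h : IsSingularExpansion N s p q X)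
    (hN : n ≤ N) {φ φ' : ℝ → ℝ} (hmono : MonotoneOn φ' (Set.Ici 0))
    (hnonneg : ∀ a, 0 ≤ a → 0 ≤ φ' a)
    (htan : ∀ a b, 0 ≤ a → 0 ≤ b → φ a + φ' a * (b - a) ≤ φ b) (Y : Matrix (Fin m) (Fin n) ℝ) :
    ∑ i ∈ range N, φ (s i) +
        inner ℝ (∑ i ∈ range N, φ' (s i) • vecMulVec (p i) (q i)) (Y - X) ≤
      ∑ i ∈ range N, φ (sigma Y i) := by
  obtain ⟨p', q', h'⟩ := exists_isSingularExpansion Y hN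
  have h1 : inner ℝ (∑ i ∈ range N, φ' (s i) • vecMulVec (p i) (q i)) Y ≤
      ∑ i ∈ range N, φ' (s i) * sigma Y i := by
    conv_lhs => rw [h'.eq]
    exact inner_sum_vecMulVec_le (fun i j hij => hmono (h.nonneg j) (h.nonneg i) (h.antitone hij))
      (fun i => hnonneg _ (h.nonneg i)) h'.antitone h'.nonneg h.left h.right h'.left h'.right N
  have h2 := Finset.sum_le_sum fun i (_ : i ∈ range N) =>
    htan (s i) (sigma Y i) (h.nonneg i) (sigma_nonneg Y i)
  simp only [mul_sub, sum_add_distrib, sum_sub_distrib] at h2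
  rw [inner_sub_right, h.inner_eq]
  linarith

theorem tangent_le_of_convexOn {φ : ℝ → ℝ} {S : Set ℝ} (hφ : ConvexOn ℝ S φ) {a b d : ℝ}
    (ha : a ∈ S) (hb : b ∈ S) (hd : HasDerivWithinAt φ d S a) : φ a + d * (b - a) ≤ φ b := by
  rcases lt_trichotomy a b with hab | rfl | hab
  · have := hφ.le_slope_of_hasDerivWithinAt ha hb hab hd
    rw [slope_def_field, le_div_iff₀ (by linarith)] at this
    linarith
  · simp
  · have := hφ.slope_le_of_hasDerivWithinAt hb ha hab hd
    rw [slope_def_field, div_le_iff₀ (by linarith)] at this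
    linarith

/-! ### The scalar penalty -/

/-- The convex function `α ↦ κ₀ α - κ(α)`, in terms of which `ḡ(X) = -μ ∑ᵢ gap(σᵢ(X))`. -/
noncomputable def gap (κ : ℝ → ℝ) (α : ℝ) : ℝ := kappaZero κ * α - κ α

/-- The derivative of `gap κ` on `[0, ∞)`. -/
noncomputable def gapDeriv (κ : ℝ → ℝ) (α : ℝ) : ℝ := kappaZero κ - kappaDeriv κ α

namespace IsPenalty

variable {κ : ℝ → ℝ} {ρ : ℝ≥0}

theorem hasDerivWithinAt_gap (h : IsPenalty κ ρ) {a : ℝ} (ha : 0 ≤ a) :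
    HasDerivWithinAt (gap κ) (gapDeriv κ a) (Set.Ici 0) a := by
  have h1 := (hasDerivWithinAt_id a (Set.Ici 0)).const_mul (kappaZero κ)
  rw [mul_one] at h1
  exact h1.sub (h.differentiable a ha).hasDerivWithinAt

theorem gap_zero (h : IsPenalty κ ρ) : gap κ 0 = 0 := by
  simp [gap, h.map_zero]

theorem gapDeriv_monotoneOn (h : IsPenalty κ ρ) : MonotoneOn (gapDeriv κ) (Set.Ici 0) :=
  fun _ ha _ hb hab =>
    sub_le_sub_left (h.concave.antitoneOn_derivWithin h.differentiable ha hb hab) _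

theorem gapDeriv_nonneg (h : IsPenalty κ ρ) {a : ℝ} (ha : 0 ≤ a) : 0 ≤ gapDeriv κ a := by
  simpa [gapDeriv, kappaZero] using h.gapDeriv_monotoneOn (Set.mem_Ici.2 le_rfl) ha ha

theorem gapDeriv_sub_le (h : IsPenalty κ ρ) {a b : ℝ} (ha : 0 ≤ a) (hab : a ≤ b) :
    gapDeriv κ b - gapDeriv κ a ≤ ρ * (b - a) := by
  have := h.lipschitz_deriv.dist_le_mul b (ha.trans hab) a ha
  rw [Real.dist_eq, Real.dist_eq, abs_of_nonneg (sub_nonneg.2 hab)] at this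
  have := neg_le_of_abs_le this
  simp only [gapDeriv, kappaDeriv]
  linarith

theorem gap_tangent (h : IsPenalty κ ρ) {a b : ℝ} (ha : 0 ≤ a) (hb : 0 ≤ b) :
    gap κ a + gapDeriv κ a * (b - a) ≤ gap κ b := by
  refine tangent_le_of_convexOn (S := Set.Ici 0) ?_ ha hb (h.hasDerivWithinAt_gap ha)
  exact ((LinearMap.mulLeft ℝ (kappaZero κ)).convexOn (convex_Ici 0)).sub h.concave

/-- The derivative of `α ↦ ρ/2 α² - gap κ α` is non-decreasing because `gapDeriv κ` is
`ρ`-Lipschitz. -/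
theorem residual_monotoneOn (h : IsPenalty κ ρ) :
    MonotoneOn (fun a => ρ * a - gapDeriv κ a) (Set.Ici 0) := fun a ha b _ hab => by
  have := h.gapDeriv_sub_le ha hab
  dsimp only
  linarith

theorem residual_nonneg (h : IsPenalty κ ρ) {a : ℝ} (ha : 0 ≤ a) :
    0 ≤ ρ * a - gapDeriv κ a := by
  simpa [gapDeriv, kappaZero] using h.residual_monotoneOn (Set.mem_Ici.2 le_rfl) ha ha

/-- The tangent line inequality for the convex function `α ↦ ρ/2 α² - gap κ α`. -/
theorem residual_tangent (h : IsPenalty κ ρ) {a b : ℝ} (ha : 0 ≤ a) (hb : 0 ≤ b) :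
    (ρ / 2 * a ^ 2 - gap κ a) + (ρ * a - gapDeriv κ a) * (b - a) ≤ ρ / 2 * b ^ 2 - gap κ b := by
  have hder : ∀ a, 0 ≤ a → HasDerivWithinAt (fun a => ρ / 2 * a ^ 2 - gap κ a)
      (ρ * a - gapDeriv κ a) (Set.Ici 0) a := by
    intro a ha
    have h1 := ((hasDerivWithinAt_id a (Set.Ici 0)).pow 2).const_mul ((ρ : ℝ) / 2)
    refine (h1.sub (h.hasDerivWithinAt_gap ha)).congr_deriv ?_
    simp
    ring
  have hderiv : ∀ a ∈ interior (Set.Ici (0 : ℝ)), HasDerivAt (fun a => ρ / 2 * a ^ 2 - gap κ a)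
      (ρ * a - gapDeriv κ a) a := fun a ha =>
    (hder a (interior_subset ha)).hasDerivAt (mem_interior_iff_mem_nhds.1 ha)
  refine tangent_le_of_convexOn (φ := fun a => ρ / 2 * a ^ 2 - gap κ a) (S := Set.Ici 0) ?_ ha hb
    (hder a ha)
  refine MonotoneOn.convexOn_of_deriv (convex_Ici 0)
    (fun a ha => (hder a ha).continuousWithinAt)
    (fun a ha => (hderiv a ha).differentiableAt.differentiableWithinAt) ?_
  intro a ha b hb hab
  rw [(hderiv a ha).deriv, (hderiv b hb).deriv]
  exact h.residual_monotoneOn (interior_subset ha) (interior_subset hb) hab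

end IsPenalty

/-! ### The gradient -/

/-- The first order expansion of `∑ᵢ gap κ (σᵢ(Y))` at `X` has an error between `0` and
`ρ/2 ‖Y - X‖²`. -/
theorem hasGradientAt_sum_gap {κ : ℝ → ℝ} {ρ : ℝ≥0} (hκ : IsPenalty κ ρ) {N : ℕ} {s : ℕ → ℝ}
    {p : ℕ → Fin m → ℝ} {q : ℕ → Fin n → ℝ} {X : Matrix (Fin m) (Fin n) ℝ}
    (h : IsSingularExpansion N s p q X) (hN : n ≤ N) :
    HasGradientAt (fun Y : Matrix (Fin m) (Fin n) ℝ => ∑ i ∈ range N, gap κ (sigma Y i))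
      (∑ i ∈ range N, gapDeriv κ (s i) • vecMulVec (p i) (q i)) X := by
  set W := ∑ i ∈ range N, gapDeriv κ (s i) • vecMulVec (p i) (q i) with hW
  have hs : ∀ φ : ℝ → ℝ, ∑ i ∈ range N, φ (sigma X i) = ∑ i ∈ range N, φ (s i) := fun φ =>
    sum_congr rfl fun i hi => by rw [h.eq_sigma hN (mem_range.1 hi)]
  have hbound : ∀ Y : Matrix (Fin m) (Fin n) ℝ,
      ‖∑ i ∈ range N, gap κ (sigma Y i) - ∑ i ∈ range N, gap κ (sigma X i) - inner ℝ W (Y - X)‖ ≤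
        ρ / 2 * ‖‖Y - X‖ ^ 2‖ := by
    intro Y
    have hlow := h.sum_add_inner_le hN hκ.gapDeriv_monotoneOn (fun _ => hκ.gapDeriv_nonneg)
      (fun _ _ => hκ.gap_tangent) Y
    have hup := h.sum_add_inner_le hN (φ := fun a => ρ / 2 * a ^ 2 - gap κ a)
      hκ.residual_monotoneOn (fun _ => hκ.residual_nonneg) (fun _ _ => hκ.residual_tangent) Y
    -- The subgradient belonging to `ρ/2 α² - gap κ α` is `ρ X - W`.
    have hWres : ∑ i ∈ range N, (ρ * s i - gapDeriv κ (s i)) • vecMulVec (p i) (q i) =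
        (ρ : ℝ) • X - W := by
      conv_rhs => rw [h.eq]
      simp only [hW, sub_smul, sum_sub_distrib, smul_sum, mul_smul]
    obtain ⟨p', q', h'⟩ := exists_isSingularExpansion Y hN
    simp only [sum_sub_distrib, ← mul_sum] at hup
    rw [hWres, ← h.norm_sq_eq, ← h'.norm_sq_eq, inner_sub_left, real_inner_smul_left,
      inner_sub_right X, real_inner_self_eq_norm_sq] at hup
    rw [← hW] at hlow
    have hn : ‖Y - X‖ ^ 2 = ‖Y‖ ^ 2 - 2 * inner ℝ X Y + ‖X‖ ^ 2 := by
      rw [norm_sub_sq_real, real_inner_comm]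
    have hnn : 0 ≤ (ρ : ℝ) / 2 * ‖Y - X‖ ^ 2 := by positivity
    rw [hs, Real.norm_eq_abs, Real.norm_of_nonneg (sq_nonneg _), abs_le]
    rw [hn] at hnn ⊢
    constructor
    · linarith
    · linarith
  rw [hasGradientAt_iff_isLittleO]
  refine (Asymptotics.IsBigO.of_bound _ (Filter.Eventually.of_forall hbound)).trans_isLittleO ?_
  refine Asymptotics.isLittleO_norm_right.1 ?_
  have h0 : Filter.Tendsto (fun Y : Matrix (Fin m) (Fin n) ℝ => ‖Y - X‖) (nhds X) (nhds 0) := by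
    have : Continuous fun Y : Matrix (Fin m) (Fin n) ℝ => ‖Y - X‖ := by fun_prop
    simpa using this.tendsto X
  have hlit := (Asymptotics.isLittleO_pow_id (𝕜 := ℝ) one_lt_two).comp_tendsto h0
  exact hlit

/-- The columns of a matrix as a sequence of vectors, continued by zero vectors. -/
noncomputable def colSeq {l k : ℕ} (P : Matrix (Fin l) (Fin k) ℝ) (i : ℕ) : Fin l → ℝ :=
  if h : i < k then fun a => P a ⟨i, h⟩ else 0

theorem colSeq_dotProduct {l k : ℕ} {P : Matrix (Fin l) (Fin k) ℝ} (hP : P.transpose * P = 1)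
    (i j : ℕ) : colSeq P i ⬝ᵥ colSeq P j = if i = j ∧ i < k then 1 else 0 := by
  by_cases hi : i < k
  · by_cases hj : j < k
    · have := congrFun (congrFun hP ⟨i, hi⟩) ⟨j, hj⟩
      simp only [Matrix.mul_apply, transpose_apply, Matrix.one_apply, Fin.mk.injEq] at this
      simpa [colSeq, hi, hj, dotProduct] using this
    · simp only [colSeq, dif_neg hj, dotProduct_zero]
      rw [if_neg (by omega)]
  · simp [colSeq, hi]

theorem isOrthoSystem_colSeq {l k : ℕ} {P : Matrix (Fin l) (Fin k) ℝ}
    (hP : P.transpose * P = 1) : IsOrthoSystem (colSeq P) where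
  orthogonal i j hij := by simp [colSeq_dotProduct hP, hij]
  self_le i := by
    rw [colSeq_dotProduct hP]
    split_ifs <;> norm_num

theorem mul_diagonal_mul_transpose {k N : ℕ} (hN : k ≤ N) (P : Matrix (Fin m) (Fin k) ℝ)
    (Q : Matrix (Fin n) (Fin k) ℝ) (d : ℕ → ℝ) :
    P * diagonal (fun i : Fin k => d i) * Q.transpose =
      ∑ i ∈ range N, d i • vecMulVec (colSeq P i) (colSeq Q i) := by
  rw [← sum_subset (range_subset_range.2 hN) (fun i _ hi => by
    simp [colSeq, show ¬ i < k by simpa using hi]), ← Fin.sum_univ_eq_sum_range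
      (fun i => d i • vecMulVec (colSeq P i) (colSeq Q i))]
  ext a c
  rw [Matrix.sum_apply, Matrix.mul_apply]
  refine sum_congr rfl fun i _ => ?_
  simp [mul_diagonal, vecMulVec_apply, colSeq]
  ring

theorem isSingularExpansion_of_eq {k N : ℕ} (hN : k ≤ N) {P : Matrix (Fin m) (Fin k) ℝ}
    {Q : Matrix (Fin n) (Fin k) ℝ} (hP : P.transpose * P = 1) (hQ : Q.transpose * Q = 1)
    {s : ℕ → ℝ} (hs : Antitone s) (hs0 : ∀ i, 0 ≤ s i) (hsk : ∀ i, k ≤ i → s i = 0)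
    {X : Matrix (Fin m) (Fin n) ℝ}
    (hX : X = P * diagonal (fun i : Fin k => s i) * Q.transpose) :
    IsSingularExpansion N s (colSeq P) (colSeq Q) X where
  antitone := hs
  nonneg := hs0
  left := isOrthoSystem_colSeq hP
  right := isOrthoSystem_colSeq hQ
  left_norm i := by
    rcases lt_or_ge i k with hi | hi
    · simp [colSeq_dotProduct hP, hi]
    · simp [hsk i hi]
  right_norm i := by
    rcases lt_or_ge i k with hi | hi
    · simp [colSeq_dotProduct hQ, hi]
    · simp [hsk i hi]
  eq := hX.trans (mul_diagonal_mul_transpose hN P Q s)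

theorem gBar_eq {κ : ℝ → ℝ} {ρ : ℝ≥0} (hκ : IsPenalty κ ρ) (μ : ℝ) {N : ℕ} (hN : m ≤ N)
    (Y : Matrix (Fin m) (Fin n) ℝ) :
    gBar κ μ Y = -μ * ∑ i ∈ range N, gap κ (sigma Y i) := by
  rw [← sum_subset (range_subset_range.2 hN) (fun i _ hi => by
    rw [sigma_eq_zero_of_le_left Y (by simpa using hi), hκ.gap_zero]),
    ← Fin.sum_univ_eq_sum_range (fun i => gap κ (sigma Y i)), gBar, neg_mul, ← mul_neg,
    ← sum_neg_distrib]
  simp only [gap, neg_sub]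

theorem transpose_mul_self_mul {l k : ℕ} {P : Matrix (Fin l) (Fin k) ℝ}
    (hP : P.transpose * P = 1) {O : Matrix (Fin k) (Fin k) ℝ}
    (hO : O ∈ Matrix.orthogonalGroup (Fin k) ℝ) : (P * O).transpose * (P * O) = 1 := by
  rw [transpose_mul, Matrix.mul_assoc, ← Matrix.mul_assoc P.transpose, hP, Matrix.one_mul]
  exact (Matrix.mem_orthogonalGroup_iff' (Fin k) ℝ).1 hO

end LowRankGrad

theorem corollary3 {m n k : ℕ}
    (κ : ℝ → ℝ) (ρ : ℝ≥0) (hκ : LowRankGrad.IsPenalty κ ρ)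
    (μ : ℝ) (hμ : 0 ≤ μ)
    (f : Matrix (Fin m) (Fin n) ℝ → ℝ)
    (U : Matrix (Fin m) (Fin k) ℝ) (hU : U.transpose * U = 1)
    (V : Matrix (Fin n) (Fin k) ℝ) (hV : V.transpose * V = 1)
    (B : Matrix (Fin k) (Fin k) ℝ) (hB : B.PosSemidef)
    (X : Matrix (Fin m) (Fin n) ℝ) (hX : X = U * B * V.transpose)
    (hf : DifferentiableAt ℝ f X)
    (UB VB : Matrix (Fin k) (Fin k) ℝ) (hSVD : LowRankGrad.IsSVD B UB VB) :
    DifferentiableAt ℝ (LowRankGrad.fBar f κ μ) X ∧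
      ∇ (LowRankGrad.fBar f κ μ) X = ∇ f X +
        μ • ((U * UB) *
          Matrix.diagonal (fun i : Fin k =>
            LowRankGrad.kappaDeriv κ (LowRankGrad.sigma B i) - LowRankGrad.kappaZero κ) *
          (V * VB).transpose) := by
  -- A common length `N = m + n + k` of all sums: every singular value involved vanishes beyond it.
  have hmN : m ≤ m + n + k := by omega
  have hnN : n ≤ m + n + k := by omega
  have hkN : k ≤ m + n + k := by omega
  have hexp : LowRankGrad.IsSingularExpansion (m + n + k) (LowRankGrad.sigma B)
      (LowRankGrad.colSeq (U * UB)) (LowRankGrad.colSeq (V * VB)) X := by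
    refine LowRankGrad.isSingularExpansion_of_eq hkN
      (LowRankGrad.transpose_mul_self_mul hU hSVD.left_mem)
      (LowRankGrad.transpose_mul_self_mul hV hSVD.right_mem) (LowRankGrad.sigma_antitone B)
      (LowRankGrad.sigma_nonneg B) (fun i => LowRankGrad.sigma_eq_zero_of_le_right B) ?_
    rw [hX]
    conv_lhs => rw [hSVD.eq]
    simp only [Matrix.transpose_mul, Matrix.mul_assoc]
  have hgrad := LowRankGrad.hasGradientAt_sum_gap hκ hexp hnN
  have hfun : LowRankGrad.fBar f κ μ = fun Y => f Y +
      -μ * ∑ i ∈ Finset.range (m + n + k), LowRankGrad.gap κ (LowRankGrad.sigma Y i) :=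
    funext fun Y => by rw [LowRankGrad.fBar, LowRankGrad.gBar_eq hκ μ hmN]
  have hmain : HasGradientAt (LowRankGrad.fBar f κ μ) (∇ f X + μ • ((U * UB) *
      Matrix.diagonal (fun i : Fin k =>
        LowRankGrad.kappaDeriv κ (LowRankGrad.sigma B i) - LowRankGrad.kappaZero κ) *
      (V * VB).transpose)) X := by
    rw [hfun, LowRankGrad.mul_diagonal_mul_transpose hkN _ _
      fun i => LowRankGrad.kappaDeriv κ (LowRankGrad.sigma B i) - LowRankGrad.kappaZero κ,
      hasGradientAt_iff_hasFDerivAt]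
    have hneg : ∑ i ∈ Finset.range (m + n + k),
        (LowRankGrad.kappaDeriv κ (LowRankGrad.sigma B i) - LowRankGrad.kappaZero κ) •
          Matrix.vecMulVec (LowRankGrad.colSeq (U * UB) i) (LowRankGrad.colSeq (V * VB) i) =
        -∑ i ∈ Finset.range (m + n + k), LowRankGrad.gapDeriv κ (LowRankGrad.sigma B i) •
          Matrix.vecMulVec (LowRankGrad.colSeq (U * UB) i) (LowRankGrad.colSeq (V * VB) i) := by
      rw [← Finset.sum_neg_distrib]
      exact Finset.sum_congr rfl fun i _ => by rw [LowRankGrad.gapDeriv, ← neg_smul, neg_sub]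
    refine (hf.hasGradientAt.hasFDerivAt.add
      (hgrad.hasFDerivAt.const_mul (-μ))).congr_fderiv (ContinuousLinearMap.ext fun Y => ?_)
    rw [hneg]
    simp only [add_apply, smul_apply,
      InnerProductSpace.toDual_apply_apply, inner_add_left, real_inner_smul_left, inner_neg_left,
      smul_eq_mul]
    ring
  exact ⟨hmain.differentiableAt, hmain.gradient⟩
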